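/- Words are finite words over the alphabet $\{0,1\}$; $|w|$ is the length of $w$ and $|w|_i$ its number of occurrences of the letter $i$. A word $u$ is a factor of $w$ if $w=pus$ for some (possibly empty) words $p,s$; it is a proper factor if moreover $u\neq w$. A word $w$ is primitive if $w=v^n$ implies $n=1$. A word is balanced if the numbers of $1$s in any two of its factors of the same length differ by at most $1$; let $\mathit{Bal}$ be the set of balanced words. An imbalance pair of a word $w$ is an unordered pair $\{u,v\}$ of factors of $w$ of the same length with $\bigl||u|_1-|v|_1\bigr|\ge 2$. A word is almost balanced if it has exactly one imbalance pair; it is minimal almost balanced if it is almost balanced and none of its proper factors is almost balanced. Let $\mathit{MAB}$ be the set of minimal almost balanced words. A minimal forbidden word for a language $L$ is a word that is not in $L$ but all of whose proper factors are in $L$; let $\mathcal{MF}(L)$ be the set of these words. A word encodes a lattice path starting at $(0,0)$, where $0$ is a horizontal and $1$ a vertical unit step. For nonnegative integers $a,b$, not both $0$, the lower (resp. upper) Christoffel word of $(a,b)$ is the word encoding the path from $(0,0)$ to $(a,b)$ that stays weakly below (resp. above) the segment joining these two points and is closest to it among all such paths: after every number of steps, it is at least as high (resp. at most as high) as each other such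 path. A primitive Christoffel word is a lower or upper Christoffel word that is primitive. **Theorem.** $$\mathit{MAB}=\{\,ywx \;:\; \{x,y\}=\{0,1\},\ w\in\{0,1\}^*,\ xwy=cc \text{ for some primitive Christoffel word } c\,\}.$$ Consequently, $\mathit{MAB}\subseteq\mathcal{MF}(\mathit{Bal})$, i.e., every minimal almost balanced word is a minimal forbidden word for the language of balanced words. -/

import Mathlib

/-- Words over the alphabet `{0, 1}`; `u <:+: w` means that `u` is a factor of `w`. -/
abbrev BinWord := List (Fin 2)

/-- `w` is balanced: the numbers of ones in two factors of the same length differ by at most `1`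
(both orders of the pair `u, v` are covered by the quantifiers). -/
def IsBalanced (w : BinWord) : Prop :=
  ∀ u v : BinWord, u <:+: w → v <:+: w → u.length = v.length → v.count 1 ≤ u.count 1 + 1

/-- The language of balanced binary words. -/
def Bal : Set BinWord := {w | IsBalanced w}

/-- The minimal forbidden words of a language `L`: the words outside `L` all of whose proper
factors are in `L`. -/
def MinimalForbidden (L : Set BinWord) : Set BinWord :=
  {w | w ∉ L ∧ ∀ u : BinWord, u <:+: w → u ≠ w → u ∈ L}

/-- `u, v` is an imbalance pair of `w`: two factors of `w` of the same length whose numbers of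
ones differ by at least `2`. The factor with fewer ones is listed first, so that every unordered
pair of words is counted exactly once. -/
def IsImbalancePair (w u v : BinWord) : Prop :=
  u <:+: w ∧ v <:+: w ∧ u.length = v.length ∧ u.count 1 + 2 ≤ v.count 1

/-- `w` is almost balanced: it has a unique imbalance pair of factors. -/
def IsAlmostBalanced (w : BinWord) : Prop :=
  ∃! p : BinWord × BinWord, IsImbalancePair w p.1 p.2

/-- The minimal almost balanced words: the almost balanced words none of whose proper factors is
almost balanced. -/
def MAB : Set BinWord :=
  {w | IsAlmostBalanced w ∧ ∀ u : BinWord, u <:+: w → u ≠ w → ¬ IsAlmostBalanced u}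

/-- `w` is primitive: `w = v ^ n` only for `n = 1`. -/
def IsPrimitiveWord (w : BinWord) : Prop :=
  ∀ (v : BinWord) (n : ℕ), w = (List.replicate n v).flatten → n = 1

/-- `w` encodes a lattice path from `(0, 0)` to `(a, b)`, where `0` is a horizontal and `1` a
vertical unit step. -/
def IsPathTo (a b : ℕ) (w : BinWord) : Prop :=
  w.count 0 = a ∧ w.count 1 = b

/-- `w` encodes a path from `(0, 0)` to `(a, b)` that stays weakly below the segment joining
these points: each visited point `(p.count 0, p.count 1)` is on or below it. -/
def IsPathBelow (a b : ℕ) (w : BinWord) : Prop :=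
  IsPathTo a b w ∧ ∀ p : BinWord, p <+: w → a * p.count 1 ≤ b * p.count 0

/-- `w` encodes a path from `(0, 0)` to `(a, b)` that stays weakly above the segment joining
these points. -/
def IsPathAbove (a b : ℕ) (w : BinWord) : Prop :=
  IsPathTo a b w ∧ ∀ p : BinWord, p <+: w → b * p.count 0 ≤ a * p.count 1

/-- `w` is the lower Christoffel word of `(a, b)`: among the paths from `(0, 0)` to `(a, b)` below
the segment it is the closest one to the segment, that is, after any number `k` of steps it is at
least as high as each other such path. -/
def IsLowerChristoffel (a b : ℕ) (w : BinWord) : Prop :=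
  IsPathBelow a b w ∧
    ∀ w' : BinWord, IsPathBelow a b w' → ∀ k : ℕ, (w'.take k).count 1 ≤ (w.take k).count 1

/-- `w` is the upper Christoffel word of `(a, b)`: among the paths from `(0, 0)` to `(a, b)` above
the segment it is the closest one to the segment, that is, after any number `k` of steps it is at
most as high as each other such path. -/
def IsUpperChristoffel (a b : ℕ) (w : BinWord) : Prop :=
  IsPathAbove a b w ∧
    ∀ w' : BinWord, IsPathAbove a b w' → ∀ k : ℕ, (w.take k).count 1 ≤ (w'.take k).count 1

/-- `w` is a (lower or upper, not necessarily primitive) Christoffel word. -/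
def IsChristoffel (w : BinWord) : Prop :=
  ∃ a b : ℕ, (a, b) ≠ (0, 0) ∧ (IsLowerChristoffel a b w ∨ IsUpperChristoffel a b w)

/-! Reversal exchanges lower and upper Christoffel words and preserves `MAB`, so it suffices to
treat lower words c = 0p1 of length n with b ones, for which ywx is z = 1p1·0p0. Primitive lower
Christoffel words are handled through `StrictLower`: at each interior k, the number of ones in the
prefix is the floor of bk/n, and bk/n is not an integer.

From c to z: the discrepancy n·(ones among the first j letters of z) - bj lies in [0, n], is 0 only
at the ends and n only at the midpoint (`discrepancy_swappedSquare`). An imbalance of 2 needs all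
four window ends to be extremal, which leaves only the pair 0p0, 1p1.

From z to c: if (u, v) is the unique pair of z in `MAB`, no proper factor contains a pair, so u and
v sit at the two ends of z. Uniqueness makes them the two halves, and they differ only in their
first and last letters (`exists_eq_swappedSquare`). Averaging the counts of windows of length k over
one period yields the strict inequalities for c (`strictLower_of_isAlmostBalanced`). -/

/-! ### Letter counts of prefixes and windows -/

theorem count_zero_add_count_one (w : BinWord) : w.count 0 + w.count 1 = w.length := by
  induction w with
  | nil => rfl
  | cons x l ih =>
    match x with
    | 0 => simp; omega
    | 1 => simp; omega

theorem eq_of_count_take_eq {w w' : BinWord} (hl : w.length = w'.length)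
    (h : ∀ k, (w.take k).count 1 = (w'.take k).count 1) : w = w' := by
  induction w generalizing w' with
  | nil => exact (List.length_eq_zero_iff.mp hl.symm).symm
  | cons x l ih =>
    cases w' with
    | nil => simp at hl
    | cons y l' =>
      have hxy : x = y := by
        have := h 1
        match x, y with
        | 0, 0 => rfl
        | 1, 1 => rfl
        | 0, 1 => simp at this
        | 1, 0 => simp at this
      subst hxy
      rw [ih (by simpa using hl) fun k => by simpa [List.count_cons] using h (k + 1)]

theorem count_take_add (z : BinWord) (i k : ℕ) :
    (z.take (i + k)).count 1 = (z.take i).count 1 + ((z.drop i).take k).count 1 := by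
  rw [List.take_add, List.count_append]

theorem window_isInfix (z : BinWord) (i k : ℕ) : (z.drop i).take k <:+: z :=
  (List.take_prefix _ _).isInfix.trans (List.drop_suffix _ _).isInfix

theorem List.IsInfix.exists_window {u z : BinWord} (h : u <:+: z) :
    ∃ i, i + u.length ≤ z.length ∧ u = (z.drop i).take u.length := by
  obtain ⟨s, t, rfl⟩ := h
  exact ⟨s.length, by simp, by simp⟩

/-! ### Primitive lower Christoffel words as strict floor words -/

/-- The path of `c` stays strictly below the segment joining its ends, except at the ends, at
vertical distance less than that of a closest path. -/
def StrictLower (c : BinWord) : Prop :=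
  ∀ k, 0 < k → k < c.length → c.length * (c.take k).count 1 < c.count 1 * k ∧
    c.count 1 * k < c.length * ((c.take k).count 1 + 1)

/-- The letters of the closest path of length `n` below the line through the origin and a point
with `b` vertical and `n` total steps. -/
def floorLetter (b n i : ℕ) : Fin 2 := if b * (i + 1) / n = b * i / n then 0 else 1

/-- The closest path with `b` vertical and `n` total steps below the segment joining its ends. -/
def floorWord (b n : ℕ) : BinWord := (List.range n).map (floorLetter b n)

theorem count_map_floorLetter {b n : ℕ} (hb : b ≤ n) (hn : 0 < n) (k : ℕ) :
    ((List.range k).map (floorLetter b n)).count 1 = b * k / n := by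
  induction k with
  | zero => simp
  | succ k ih =>
    have h1 : b * k / n ≤ b * (k + 1) / n := Nat.div_le_div_right (by nlinarith)
    have h2 : b * (k + 1) / n ≤ b * k / n + 1 := by
      rw [← Nat.add_div_right _ hn]
      exact Nat.div_le_div_right (by nlinarith)
    rw [List.range_succ, List.map_append, List.count_append, ih]
    by_cases h : b * (k + 1) / n = b * k / n
    · simp [floorLetter, h]
    · simp [floorLetter, h]; omega

theorem count_take_floorWord {b n : ℕ} (hb : b ≤ n) (hn : 0 < n) {k : ℕ} (hk : k ≤ n) :
    ((floorWord b n).take k).count 1 = b * k / n := by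
  rw [floorWord, ← List.map_take, List.take_range, min_eq_left hk, count_map_floorLetter hb hn]

theorem length_floorWord (b n : ℕ) : (floorWord b n).length = n := by simp [floorWord]

theorem isPathBelow_iff {a b : ℕ} {w : BinWord} : IsPathBelow a b w ↔
    w.length = a + b ∧ w.count 1 = b ∧
      ∀ k ≤ w.length, (a + b) * (w.take k).count 1 ≤ b * k := by
  have hw := count_zero_add_count_one w
  constructor
  · rintro ⟨⟨h0, h1⟩, h⟩
    refine ⟨by omega, h1, fun k hk => ?_⟩
    have := h _ (List.take_prefix k w)
    have hk' := count_zero_add_count_one (w.take k)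
    rw [List.length_take, min_eq_left hk] at hk'
    nlinarith
  · rintro ⟨hl, h1, h⟩
    refine ⟨⟨by omega, h1⟩, fun p hp => ?_⟩
    have := h _ hp.length_le
    rw [← List.prefix_iff_eq_take.mp hp] at this
    have := count_zero_add_count_one p
    nlinarith

theorem isPathBelow_floorWord {a b : ℕ} (h : 0 < a + b) :
    IsPathBelow a b (floorWord b (a + b)) := by
  have hc := fun k hk => count_take_floorWord (b := b) (n := a + b) (by omega) h (k := k) hk
  rw [isPathBelow_iff, length_floorWord]
  refine ⟨rfl, ?_, fun k hk => ?_⟩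
  · have := hc _ le_rfl
    rwa [List.take_of_length_le (length_floorWord _ _).le, Nat.mul_div_cancel _ h] at this
  · rw [hc k hk]
    exact Nat.mul_div_le _ _

theorem IsPathBelow.count_take_le {a b : ℕ} {w : BinWord} (h : IsPathBelow a b w)
    (hab : 0 < a + b) {k : ℕ} (hk : k ≤ a + b) : (w.take k).count 1 ≤ b * k / (a + b) := by
  obtain ⟨hl, -, h⟩ := isPathBelow_iff.mp h
  rw [Nat.le_div_iff_mul_le hab, mul_comm]
  exact h k (hl ▸ hk)

/-- Being below the segment bounds each prefix count by the floor; closeness, tested against the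
floor word, gives the reverse bound. -/
theorem IsLowerChristoffel.eq_floorWord {a b : ℕ} {c : BinWord} (h : IsLowerChristoffel a b c)
    (hab : 0 < a + b) : c = floorWord b (a + b) := by
  have hl := (isPathBelow_iff.mp h.1).1
  have key : ∀ k ≤ a + b, (c.take k).count 1 = ((floorWord b (a + b)).take k).count 1 := by
    intro k hk
    refine le_antisymm ?_ (h.2 _ (isPathBelow_floorWord hab) k)
    rw [count_take_floorWord (by omega) hab hk]
    exact h.1.count_take_le hab hk
  refine eq_of_count_take_eq (by rw [hl, length_floorWord]) fun k => ?_
  rcases le_total k (a + b) with hk | hk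
  · exact key k hk
  · rw [List.take_of_length_le (by omega), List.take_of_length_le (by rwa [length_floorWord])]
    have := key _ le_rfl
    rwa [List.take_of_length_le (by omega),
      List.take_of_length_le (by rw [length_floorWord])] at this

theorem map_range_mul_of_periodic {α : Type*} (f : ℕ → α) (m : ℕ) (hf : ∀ i, f (m + i) = f i)
    (d : ℕ) :
    (List.range (d * m)).map f = (List.replicate d ((List.range m).map f)).flatten := by
  induction d with
  | zero => simp
  | succ d ih =>
    have hf' : f ∘ (fun i => m + i) = f := funext hf
    rw [Nat.succ_mul, add_comm, List.range_add, List.map_append, List.map_map, hf', ih,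
      List.replicate_succ, List.flatten_cons]

theorem floorWord_eq_flatten (b m d : ℕ) (hd : 0 < d) (hm : 0 < m) :
    floorWord (d * b) (d * m) =
      (List.replicate d ((List.range m).map (floorLetter (d * b) (d * m)))).flatten := by
  refine map_range_mul_of_periodic _ m (fun i => ?_) d
  have h : ∀ j, d * b * j / (d * m) = b * j / m := fun j => by
    rw [mul_assoc, Nat.mul_div_mul_left _ _ hd]
  have h' : ∀ j, b * (m + j) / m = b + b * j / m := fun j => by
    rw [mul_add, mul_comm b m, Nat.mul_add_div hm]
  simp only [floorLetter, h, add_assoc, h', Nat.add_left_cancel_iff]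

theorem IsLowerChristoffel.strictLower {a b : ℕ} {c : BinWord} (h : IsLowerChristoffel a b c)
    (hab : (a, b) ≠ (0, 0)) (hc : IsPrimitiveWord c) : StrictLower c := by
  have hn : 0 < a + b := by
    by_contra h0
    exact hab (by simp; omega)
  obtain ⟨hl, h1, hle⟩ := isPathBelow_iff.mp h.1
  have hfl := h.eq_floorWord hn
  -- A common divisor d of a + b and b makes the floor word a d-th power, so primitivity forces d =
  -- 1.
  have hcop : Nat.Coprime (a + b) b := by
    obtain ⟨n', hn'⟩ := Nat.gcd_dvd_left (a + b) b
    obtain ⟨b', hb'⟩ := Nat.gcd_dvd_right (a + b) b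
    have hd : 0 < (a + b).gcd b := Nat.gcd_pos_of_pos_left _ hn
    have hm : 0 < n' := Nat.pos_of_ne_zero fun h0 => by rw [h0, mul_zero] at hn'; omega
    refine hc ((List.range n').map (floorLetter b (a + b))) _ (hfl.trans ?_)
    have := floorWord_eq_flatten b' n' _ hd hm
    rwa [← hn', ← hb'] at this
  intro k hk0 hk
  rw [hl] at hk ⊢
  rw [h1, hfl, count_take_floorWord (by omega) hn hk.le]
  -- Equality would put a lattice point inside the segment, which coprimality excludes.
  refine ⟨lt_of_le_of_ne (Nat.mul_div_le _ _) fun he => ?_, Nat.lt_mul_div_succ _ hn⟩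
  exact absurd (Nat.le_of_dvd hk0 (hcop.dvd_of_dvd_mul_left ⟨_, he.symm⟩)) (by omega)

/-- A proper power returns to the segment after its first block. -/
theorem StrictLower.isPrimitiveWord {c : BinWord} (h : StrictLower c) (hc : c ≠ []) :
    IsPrimitiveWord c := by
  intro v m hm
  match m with
  | 0 => exact absurd (by simpa using hm) hc
  | 1 => rfl
  | m + 2 =>
    exfalso
    have hv : 0 < v.length := List.length_pos_iff.mpr fun h0 => hc (by simp [hm, h0])
    have hl : c.length = (m + 2) * v.length := by simp [hm]
    have h1 : c.count 1 = (m + 2) * v.count 1 := by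
      simp [hm, List.count_flatten]
    have ht : c.take v.length = v := by
      rw [hm, List.replicate_succ, List.flatten_cons, List.take_left]
    have := (h v.length hv (by nlinarith)).1
    rw [ht, hl, h1] at this
    nlinarith

theorem StrictLower.isLowerChristoffel {c : BinWord} (h : StrictLower c) :
    IsLowerChristoffel (c.count 0) (c.count 1) c := by
  have hl := count_zero_add_count_one c
  refine ⟨isPathBelow_iff.mpr ⟨hl.symm, rfl, fun k hk => ?_⟩, fun w' hw' k => ?_⟩
  · rw [hl]
    rcases Nat.eq_zero_or_pos k with rfl | hk0
    · simp
    rcases hk.lt_or_eq with hk | rfl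
    · exact (h k hk0 hk).1.le
    · rw [List.take_length, mul_comm]
  · obtain ⟨hl', h1', hw'⟩ := isPathBelow_iff.mp hw'
    rcases Nat.eq_zero_or_pos k with rfl | hk0
    · simp
    rcases lt_or_ge k c.length with hk | hk
    · have h2 := (h k hk0 hk).2
      have h3 := hw' k (by omega)
      rw [hl] at h3
      exact Nat.lt_succ_iff.mp (Nat.lt_of_mul_lt_mul_left (h3.trans_lt h2))
    · rw [List.take_of_length_le hk, List.take_of_length_le (by omega), h1']

/-! ### Reversal symmetry -/

theorem count_take_reverse (c : BinWord) (k : ℕ) (x : Fin 2) :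
    (c.reverse.take k).count x + (c.take (c.length - k)).count x = c.count x := by
  rw [List.take_reverse, List.count_reverse, add_comm, ← List.count_append, List.take_append_drop]

/-- Reversing a word reflects its path in the midpoint of the segment. -/
theorem IsPathBelow.reverse {a b : ℕ} {c : BinWord} (h : IsPathBelow a b c) :
    IsPathAbove a b c.reverse := by
  obtain ⟨⟨h0, h1⟩, h⟩ := h
  refine ⟨⟨by simpa using h0, by simpa using h1⟩, fun p hp => ?_⟩
  rw [List.prefix_iff_eq_take.mp hp]
  have := h _ (List.take_prefix (c.length - p.length) c)
  have e0 := count_take_reverse c p.length 0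
  have e1 := count_take_reverse c p.length 1
  nlinarith

theorem IsPathAbove.reverse {a b : ℕ} {c : BinWord} (h : IsPathAbove a b c) :
    IsPathBelow a b c.reverse := by
  obtain ⟨⟨h0, h1⟩, h⟩ := h
  refine ⟨⟨by simpa using h0, by simpa using h1⟩, fun p hp => ?_⟩
  rw [List.prefix_iff_eq_take.mp hp]
  have := h _ (List.take_prefix (c.length - p.length) c)
  have e0 := count_take_reverse c p.length 0
  have e1 := count_take_reverse c p.length 1
  nlinarith

theorem IsPathTo.length_eq {a b : ℕ} {w : BinWord} (h : IsPathTo a b w) : w.length = a + b := by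
  rw [← count_zero_add_count_one, h.1, h.2]

theorem IsLowerChristoffel.reverse {a b : ℕ} {c : BinWord} (h : IsLowerChristoffel a b c) :
    IsUpperChristoffel a b c.reverse := by
  refine ⟨h.1.reverse, fun w' hw' k => ?_⟩
  have h1 := h.2 _ hw'.reverse (c.length - k)
  have h2 := count_take_reverse c k 1
  have h3 := count_take_reverse w'.reverse k 1
  have h4 := hw'.1.2
  have h5 := h.1.1.2
  rw [List.reverse_reverse, List.count_reverse, List.length_reverse, hw'.1.length_eq,
    ← h.1.1.length_eq] at h3
  omega

theorem IsUpperChristoffel.reverse {a b : ℕ} {c : BinWord} (h : IsUpperChristoffel a b c) :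
    IsLowerChristoffel a b c.reverse := by
  refine ⟨h.1.reverse, fun w' hw' k => ?_⟩
  have h1 := h.2 _ hw'.reverse (c.length - k)
  have h2 := count_take_reverse c k 1
  have h3 := count_take_reverse w'.reverse k 1
  have h4 := hw'.1.2
  have h5 := h.1.1.2
  rw [List.reverse_reverse, List.count_reverse, List.length_reverse, hw'.1.length_eq,
    ← h.1.1.length_eq] at h3
  omega

theorem IsPrimitiveWord.reverse {c : BinWord} (h : IsPrimitiveWord c) :
    IsPrimitiveWord c.reverse := by
  intro v n hv
  refine h v.reverse n ?_
  rw [← List.reverse_reverse c, hv, List.reverse_flatten, List.map_replicate, List.reverse_replicate]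

/-! ### Imbalance pairs and minimality -/

theorem IsImbalancePair.mono {t z u v : BinWord} (htz : t <:+: z) (h : IsImbalancePair t u v) :
    IsImbalancePair z u v :=
  ⟨h.1.trans htz, h.2.1.trans htz, h.2.2⟩

theorem IsImbalancePair.reverse {z u v : BinWord} (h : IsImbalancePair z u v) :
    IsImbalancePair z.reverse u.reverse v.reverse :=
  ⟨List.reverse_infix.mpr h.1, List.reverse_infix.mpr h.2.1, by simpa using h.2.2.1,
    by simpa using h.2.2.2⟩

theorem IsAlmostBalanced.reverse {z : BinWord} (h : IsAlmostBalanced z) :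
    IsAlmostBalanced z.reverse := by
  obtain ⟨⟨u, v⟩, huv, hu⟩ := h
  refine ⟨(u.reverse, v.reverse), huv.reverse, fun ⟨u', v'⟩ h' => ?_⟩
  have h2 := h'.reverse
  rw [List.reverse_reverse] at h2
  have h1 := hu (u'.reverse, v'.reverse) h2
  simp only [Prod.mk.injEq, List.reverse_eq_iff] at h1
  simp [h1]

theorem mem_MAB_reverse {z : BinWord} (h : z ∈ MAB) : z.reverse ∈ MAB := by
  refine ⟨h.1.reverse, fun u hu hne hb => h.2 u.reverse ?_ ?_ hb.reverse⟩
  · rw [← List.reverse_infix, List.reverse_reverse]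
    exact hu
  · exact fun h => hne (by rw [← h, List.reverse_reverse])

/-- Proper factors of a minimal almost balanced word have no imbalance pair. -/
theorem eq_of_mem_MAB_of_isImbalancePair {z t u v : BinWord} (h : z ∈ MAB) (ht : t <:+: z)
    (huv : IsImbalancePair t u v) : t = z := by
  by_contra hne
  obtain ⟨q, -, hq⟩ := h.1
  -- Pairs of `t` are pairs of `z`, so `t` would inherit uniqueness and be almost balanced.
  refine h.2 t ht hne ⟨(u, v), huv, fun q' hq' => ?_⟩
  rw [hq q' (hq'.mono ht), hq (u, v) (huv.mono ht)]

theorem isBalanced_iff {w : BinWord} : IsBalanced w ↔ ∀ u v, ¬ IsImbalancePair w u v := by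
  constructor
  · rintro h u v ⟨hu, hv, hl, hc⟩
    have := h u v hu hv hl
    omega
  · intro h u v hu hv hl
    by_contra hc
    exact h u v ⟨hu, hv, hl, by omega⟩

theorem MAB_subset_minimalForbidden : MAB ⊆ MinimalForbidden Bal := by
  intro z hz
  refine ⟨fun hb => ?_, fun t ht hne => isBalanced_iff.mpr fun u v huv =>
    hne (eq_of_mem_MAB_of_isImbalancePair hz ht huv)⟩
  obtain ⟨⟨u, v⟩, huv, -⟩ := hz.1
  exact isBalanced_iff.mp hb u v huv

/-! ### From Christoffel words to minimal almost balanced words -/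

/-- The word `ywx` where `xwy` is the square of `0p1`, with `x = 0` and `y = 1`. -/
def swappedSquare (p : BinWord) : BinWord := (1 :: p ++ [1]) ++ (0 :: p ++ [0])

theorem count_take_cons_append (x y : Fin 2) (p : BinWord) {k : ℕ} (hk0 : 0 < k)
    (hk : k < p.length + 2) :
    ((x :: p ++ [y]).take k).count 1 = [x].count 1 + (p.take (k - 1)).count 1 := by
  obtain ⟨k, rfl⟩ : ∃ j, k = j + 1 := ⟨k - 1, by omega⟩
  rw [List.cons_append, List.take_succ_cons, List.take_append_of_le_length (by omega),
    ← List.singleton_append, List.count_append]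
  rfl

/-- Apart from its last letter, the swapped square is the square of 0p1 with the initial 0 turned
into 1. -/
theorem count_take_swappedSquare_left (p : BinWord) {k : ℕ} (hk0 : 0 < k)
    (hk : k < p.length + 2) :
    ((swappedSquare p).take k).count 1 = ((0 :: p ++ [1]).take k).count 1 + 1 := by
  rw [swappedSquare, List.take_append_of_le_length (by simp; omega),
    count_take_cons_append _ _ _ hk0 hk, count_take_cons_append _ _ _ hk0 hk]
  simp; omega

theorem count_take_swappedSquare_right (p : BinWord) {k : ℕ} (hk : k < p.length + 2) :
    ((swappedSquare p).take (p.length + 2 + k)).count 1 =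
      (0 :: p ++ [1]).count 1 + 1 + ((0 :: p ++ [1]).take k).count 1 := by
  have hl : p.length + 2 = (1 :: p ++ [1]).length := by simp
  have h1 : (1 :: p ++ [1]).count 1 = (0 :: p ++ [1]).count 1 + 1 := by simp
  rw [swappedSquare, hl, List.take_length_add_append, List.count_append, h1]
  rcases Nat.eq_zero_or_pos k with rfl | hk0
  · simp
  · rw [count_take_cons_append _ _ _ hk0 hk, count_take_cons_append _ _ _ hk0 hk]

theorem length_swappedSquare (p : BinWord) :
    (swappedSquare p).length = (p.length + 2) + (p.length + 2) := by
  simp [swappedSquare]; omega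

theorem count_swappedSquare (p : BinWord) :
    (swappedSquare p).count 1 = 2 * (0 :: p ++ [1]).count 1 := by
  simp [swappedSquare]; omega

/-- Here `e` is the discrepancy of the prefix of length `j` from the line of slope b/n, scaled by n.
The initial 1 shifts the interior values for c from (-n, 0) to (0, n). -/
theorem discrepancy_swappedSquare {p : BinWord} (h : StrictLower (0 :: p ++ [1])) {j : ℕ}
    (hj : j ≤ (p.length + 2) + (p.length + 2)) :
    ∃ e ≤ p.length + 2, (p.length + 2) * ((swappedSquare p).take j).count 1 =
        (0 :: p ++ [1]).count 1 * j + e ∧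
      (e = 0 → j = 0 ∨ j = (p.length + 2) + (p.length + 2)) ∧ (e = p.length + 2 → j = p.length + 2) := by
  have hl : (0 :: p ++ [1]).length = p.length + 2 := by simp
  rcases Nat.eq_zero_or_pos j with rfl | hj0
  · exact ⟨0, by omega, by simp, by simp, by omega⟩
  rcases lt_trichotomy j (p.length + 2) with hjn | rfl | hjn
  · obtain ⟨h1, h2⟩ := h j hj0 (by omega)
    rw [hl] at h1 h2
    rw [count_take_swappedSquare_left p hj0 hjn]
    exact ⟨_, by rw [mul_add]; omega, (Nat.add_sub_cancel' h2.le).symm, by omega,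
      by rw [mul_add] at *; omega⟩
  · have := count_take_swappedSquare_right p (k := 0) (by omega)
    rw [add_zero] at this
    exact ⟨p.length + 2, le_rfl, by rw [this]; simp; ring, by omega, by simp⟩
  rcases hj.lt_or_eq with hj | rfl
  · obtain ⟨k, rfl⟩ : ∃ k, j = p.length + 2 + k := ⟨j - (p.length + 2), by omega⟩
    obtain ⟨h1, h2⟩ := h k (by omega) (by omega)
    rw [hl] at h1 h2
    rw [count_take_swappedSquare_right p (by omega)]
    generalize List.count 1 (0 :: p ++ [1]) = b at *
    generalize List.count 1 (List.take k (0 :: p ++ [1])) = m at *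
    refine ⟨(p.length + 2) * (m + 1) - b * k, ?_, ?_, by omega, ?_⟩
    · rw [mul_add]; omega
    · zify [h2.le]; ring
    · rw [mul_add] at *; omega
  · refine ⟨0, by omega, ?_, by omega, by omega⟩
    rw [List.take_of_length_le (length_swappedSquare p).le, count_swappedSquare]
    ring

theorem positions_of_imbalance_swappedSquare {p : BinWord} (h : StrictLower (0 :: p ++ [1]))
    {i j k : ℕ} (hi : i + k ≤ (swappedSquare p).length) (hj : j + k ≤ (swappedSquare p).length)
    (hij : (((swappedSquare p).drop i).take k).count 1 + 2 ≤
      (((swappedSquare p).drop j).take k).count 1) :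
    i = p.length + 2 ∧ j = 0 ∧ k = p.length + 2 := by
  rw [length_swappedSquare] at hi hj
  have ci := count_take_add (swappedSquare p) i k
  have cj := count_take_add (swappedSquare p) j k
  obtain ⟨e1, l1, q1, z1, n1⟩ := discrepancy_swappedSquare h (j := i) (by omega)
  obtain ⟨e2, l2, q2, z2, n2⟩ := discrepancy_swappedSquare h hi
  obtain ⟨e3, l3, q3, z3, n3⟩ := discrepancy_swappedSquare h (j := j) (by omega)
  obtain ⟨e4, l4, q4, z4, n4⟩ := discrepancy_swappedSquare h hj
  -- Scaled by n, the difference of the two window counts is (e4 - e3) - (e2 - e1), as the linear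
  -- terms cancel. Each `e` is in [0, n], so a difference of 2n makes all four extremal.
  have key : 2 * (p.length + 2) + e3 + e2 ≤ e4 + e1 := by
    have : ((swappedSquare p).take j).count 1 + ((swappedSquare p).take (i + k)).count 1 + 2 ≤
      ((swappedSquare p).take (j + k)).count 1 + ((swappedSquare p).take i).count 1 := by omega
    have := Nat.mul_le_mul_left (p.length + 2) this
    rw [mul_add, mul_add, mul_add, q1, q2, q3, q4, mul_add, mul_add] at this
    linarith
  have := n1 (by omega)
  have := n4 (by omega)
  have := z2 (by omega)
  have := z3 (by omega)
  omega

theorem swappedSquare_mem_MAB {p : BinWord} (h : StrictLower (0 :: p ++ [1])) :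
    swappedSquare p ∈ MAB := by
  have pair : IsImbalancePair (swappedSquare p) (0 :: p ++ [0]) (1 :: p ++ [1]) :=
    ⟨(List.suffix_append _ _).isInfix, (List.prefix_append _ _).isInfix, by simp, by simp⟩
  refine ⟨⟨(0 :: p ++ [0], 1 :: p ++ [1]), pair, ?_⟩, ?_⟩
  · rintro ⟨u, v⟩ ⟨hu, hv, hl, hc⟩
    obtain ⟨i, hi, hui⟩ := hu.exists_window
    obtain ⟨j, hj, hvj⟩ := hv.exists_window
    dsimp only at *
    rw [← hl] at hj hvj
    rw [hui, hvj] at hc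
    obtain ⟨e1, e2, e3⟩ := positions_of_imbalance_swappedSquare h hi hj hc
    rw [e3, e1] at hui
    rw [e3, e2] at hvj
    rw [hui, hvj]
    have hl0 : p.length + 2 = (0 :: p ++ [0]).length := by simp
    have hl1 : p.length + 2 = (1 :: p ++ [1]).length := by simp
    congr 1
    · rw [swappedSquare, hl1, List.drop_left, ← hl1, hl0, List.take_length]
    · rw [swappedSquare, hl1, List.drop_zero, List.take_left]
  · rintro t ⟨s, r, hsr⟩ hne ⟨⟨u, v⟩, ⟨hu, hv, hl, hc⟩, -⟩
    obtain ⟨i, hi, hui⟩ := hu.exists_window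
    obtain ⟨j, hj, hvj⟩ := hv.exists_window
    dsimp only at *
    have hlen : s.length + t.length + r.length = (swappedSquare p).length := by
      rw [← hsr]; simp [add_assoc]
    have win : ∀ i k, i + k ≤ t.length →
        ((swappedSquare p).drop (s.length + i)).take k = (t.drop i).take k := by
      intro i k hik
      rw [← hsr, List.append_assoc, ← List.drop_drop, List.drop_left,
        List.drop_append_of_le_length (by omega), List.take_append_of_le_length (by simp; omega)]
    rw [← hl] at hj hvj
    rw [hui, hvj, ← win _ _ hi, ← win _ _ hj] at hc
    obtain ⟨e1, e2, e3⟩ := positions_of_imbalance_swappedSquare h (by omega) (by omega) hc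
    have hN := length_swappedSquare p
    -- The only imbalanced windows reach both ends of the word, leaving no room outside `t`.
    have hs : s = [] := List.length_eq_zero_iff.mp (by omega)
    have hr : r = [] := List.length_eq_zero_iff.mp (by omega)
    exact hne (by simpa [hs, hr] using hsr)

/-! ### From minimal almost balanced words to Christoffel words -/

/-- Moving a window cyclically through one period. -/
theorem sum_windows (Q : ℕ → ℕ) (n k : ℕ) :
    ∑ i ∈ Finset.range n, Q (i + 1 + k) + ∑ i ∈ Finset.range k, Q (i + 1) =
      ∑ i ∈ Finset.range n, Q (i + 1) + ∑ i ∈ Finset.range k, Q (i + 1 + n) := by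
  have h1 := Finset.sum_range_add (fun i => Q (i + 1)) k n
  have h2 := Finset.sum_range_add (fun i => Q (i + 1)) n k
  rw [add_comm k n] at h1
  rw [h1] at h2
  have h3 : ∀ i, k + i + 1 = i + 1 + k := fun i => by omega
  have h4 : ∀ i, n + i + 1 = i + 1 + n := fun i => by omega
  simp only [h3, h4] at h2
  omega

theorem not_imbalance_of_length_ne {z u v : BinWord} (hz : IsAlmostBalanced z)
    (huv : IsImbalancePair z u v) {i j k : ℕ} (hi : i + k ≤ z.length) (hj : j + k ≤ z.length)
    (hk : k ≠ u.length) :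
    (z.take (j + k)).count 1 + (z.take i).count 1 ≤
      (z.take (i + k)).count 1 + (z.take j).count 1 + 1 := by
  obtain ⟨q, -, hq⟩ := hz
  by_contra hc
  have ci := count_take_add z i k
  have cj := count_take_add z j k
  have hp : IsImbalancePair z ((z.drop i).take k) ((z.drop j).take k) :=
    ⟨window_isInfix _ _ _, window_isInfix _ _ _, by simp; omega, by omega⟩
  have := (hq (_, _) hp).trans (hq (u, v) huv).symm
  rw [Prod.mk.injEq] at this
  apply hk
  rw [← this.1]
  simp; omega

/-- With z = vs = ru, comparing ones shows that r exceeds s exactly as v exceeds u. So (s, r) is an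
imbalance pair too, and uniqueness gives s = u. -/
theorem eq_append_of_prefix_suffix {z u v : BinWord} (hz : IsAlmostBalanced z)
    (huv : IsImbalancePair z u v) (hv : v <+: z) (hu : u <:+ z) : z = v ++ u := by
  obtain ⟨s, hs⟩ := hv
  obtain ⟨r, hr⟩ := hu
  obtain ⟨-, -, hl, hc⟩ := huv
  have h1 : s.length + v.length = r.length + u.length := by
    have := congrArg List.length (hs.trans hr.symm)
    simp at this; omega
  have h2 : v.count 1 + s.count 1 = r.count 1 + u.count 1 := by
    have := congrArg (List.count 1) (hs.trans hr.symm)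
    simpa using this
  have hp : IsImbalancePair z s r :=
    ⟨hs ▸ (List.suffix_append _ _).isInfix, hr ▸ (List.prefix_append _ _).isInfix, by omega,
      by omega⟩
  obtain ⟨q, -, hq⟩ := hz
  have := (hq (_, _) hp).trans (hq (u, v) ⟨hr ▸ (List.suffix_append _ _).isInfix,
    hs ▸ (List.prefix_append _ _).isInfix, hl, hc⟩).symm
  rw [Prod.mk.injEq] at this
  rw [← hs, this.1]

theorem prefix_suffix_of_mem_MAB {z u v : BinWord} (hz : z ∈ MAB) (huv : IsImbalancePair z u v) :
    (v <+: z ∧ u <:+ z) ∨ (u <+: z ∧ v <:+ z) := by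
  obtain ⟨hu, hv, hl, hc⟩ := huv
  obtain ⟨i, hi, hui⟩ := hu.exists_window
  obtain ⟨j, hj, hvj⟩ := hv.exists_window
  -- The shortest window covering both occurrences contains the pair, hence is all of `z`.
  have hm : (z.drop (min i j)).take (max i j - min i j + u.length) = z := by
    have sub : ∀ l, min i j ≤ l → l ≤ max i j →
        (z.drop l).take u.length <:+:
          (z.drop (min i j)).take (max i j - min i j + u.length) := by
      intro l hl1 hl2
      have : (z.drop l).take u.length = (((z.drop (min i j)).take
          (max i j - min i j + u.length)).drop (l - min i j)).take u.length := by
        rw [List.drop_take, List.drop_drop, List.take_take, Nat.add_sub_cancel' hl1,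
          min_eq_left (by omega)]
      rw [this]
      exact window_isInfix _ _ _
    refine eq_of_mem_MAB_of_isImbalancePair hz (window_isInfix _ _ _) (u := u) (v := v)
      ⟨?_, ?_, hl, hc⟩
    · have := sub i (by omega) (by omega)
      rwa [← hui] at this
    · have := sub j (by omega) (by omega)
      rwa [hl, ← hvj, ← hl] at this
  have hlen := congrArg List.length hm
  rw [List.length_take, List.length_drop] at hlen
  have hmin : min i j = 0 ∨ z.length = 0 := by omega
  have hnil : z.length ≠ 0 := by
    intro h0
    have := List.count_le_length (a := (1 : Fin 2)) (l := v)
    omega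
  rcases le_total i j with hij | hij
  · right
    have h0 : i = 0 := by omega
    have hjn : j + v.length = z.length := by omega
    refine ⟨?_, ?_⟩
    · rw [hui, h0, List.drop_zero]; exact List.take_prefix _ _
    · rw [hvj, List.take_of_length_le (by simp; omega)]; exact List.drop_suffix _ _
  · left
    have h0 : j = 0 := by omega
    have hin : i + u.length = z.length := by omega
    refine ⟨?_, ?_⟩
    · rw [hvj, h0, List.drop_zero]; exact List.take_prefix _ _
    · rw [hui, List.take_of_length_le (by simp; omega)]; exact List.drop_suffix _ _

/-- The excess of v over u in prefix counts jumps to 1 at the first letter, stays there, and jumps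
to 2 at the last. -/
theorem eq_cons_append_of_count {u v : BinWord} (hl : u.length = v.length)
    (hc : u.count 1 + 2 ≤ v.count 1)
    (h : ∀ k, 0 < k → k < u.length → (v.take k).count 1 = (u.take k).count 1 + 1)
    (hd : v.count 1 = u.count 1 + 2) :
    ∃ p, u = 0 :: p ++ [0] ∧ v = 1 :: p ++ [1] := by
  have h2 : 2 ≤ v.length := by
    have := List.count_le_length (a := (1 : Fin 2)) (l := v)
    omega
  have split : ∀ w : BinWord, 2 ≤ w.length → ∃ (x y : Fin 2) (p : BinWord), w = x :: p ++ [y] := by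
    intro w hw
    obtain ⟨x, w', rfl⟩ := List.exists_cons_of_length_pos (l := w) (by omega)
    rcases List.eq_nil_or_concat w' with rfl | ⟨p, y, rfl⟩
    · simp at hw
    · exact ⟨x, y, p, by simp⟩
  obtain ⟨x, y, p, rfl⟩ := split u (by omega)
  obtain ⟨x', y', p', rfl⟩ := split v h2
  simp only [List.cons_append, List.length_cons, List.length_append, List.length_nil] at hl h
  have hlp : p.length = p'.length := by omega
  have h' : ∀ k ≤ p.length, [x'].count 1 + (p'.take k).count 1 =
      [x].count 1 + (p.take k).count 1 + 1 := by
    intro k hk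
    have := h (k + 1) (by omega) (by omega)
    rwa [← List.cons_append, ← List.cons_append, count_take_cons_append _ _ _ (by omega) (by omega),
      count_take_cons_append _ _ _ (by omega) (by omega)] at this
  have hx := h' 0 (by omega)
  have hy := h' p.length le_rfl
  rw [List.take_length, hlp, List.take_length] at hy
  have hx' : x = 0 ∧ x' = 1 := by
    revert hx; clear * -; revert x x'; simp
  have hy' : y = 0 ∧ y' = 1 := by
    simp only [List.cons_append, List.count_cons, List.count_append, List.count_nil] at hd hy
    have : [y'].count 1 = [y].count 1 + 1 := by
      simp only [List.count_cons, List.count_nil]; omega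
    revert this; clear * -; revert y y'; decide
  obtain ⟨rfl, rfl⟩ := hx'
  obtain ⟨rfl, rfl⟩ := hy'
  have : p = p' := by
    refine eq_of_count_take_eq hlp fun k => ?_
    rcases le_total k p.length with hk | hk
    · have := h' k hk
      simp at this; omega
    · rw [List.take_of_length_le hk, List.take_of_length_le (by omega)]
      simp at hy; omega
  subst this
  exact ⟨p, rfl, rfl⟩

theorem exists_eq_swappedSquare {u v : BinWord} (hz : IsAlmostBalanced (v ++ u))
    (huv : IsImbalancePair (v ++ u) u v) : ∃ p, v ++ u = swappedSquare p := by
  have hbal := fun {i j k} => not_imbalance_of_length_ne hz huv (i := i) (j := j) (k := k)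
  obtain ⟨-, -, hl, hc⟩ := huv
  have hlen : (v ++ u).length = v.length + u.length := by simp
  have tl : ∀ k ≤ v.length, (v ++ u).take k = v.take k := fun k hk =>
    List.take_append_of_le_length hk
  have tr : ∀ k, ((v ++ u).take (v.length + k)).count 1 = v.count 1 + (u.take k).count 1 :=
    fun k => by rw [List.take_length_add_append, List.count_append]
  have a1 : ∀ k, k < u.length → (v.take k).count 1 ≤ (u.take k).count 1 + 1 := by
    intro k hk
    have := hbal (i := v.length) (j := 0) (k := k) (by omega) (by omega) (by omega)
    rw [tr, zero_add, tl k (by omega), tl _ le_rfl, List.take_length] at this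
    simp at this; omega
  -- This compares the suffixes of `v` and `u` left after `k` letters, as `a1` compares the
  -- prefixes.
  have a2 : ∀ k, 0 < k → k < u.length →
      v.count 1 + (u.take k).count 1 ≤ u.count 1 + (v.take k).count 1 + 1 := by
    intro k hk0 hk
    have := hbal (i := v.length + k) (j := k) (k := u.length - k) (by omega) (by omega) (by omega)
    rw [show k + (u.length - k) = v.length by omega,
      show v.length + k + (u.length - k) = v.length + u.length by omega, tr, tr,
      tl k (by omega), tl _ le_rfl, List.take_length, List.take_length] at this
    omega
  have h2 : 2 ≤ v.length := by
    have := List.count_le_length (a := (1 : Fin 2)) (l := v)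
    omega
  -- Cutting at k = 1, each of the two parts contributes at most 1 to the excess.
  have hd : v.count 1 = u.count 1 + 2 := by
    have := a1 1 (by omega)
    have := a2 1 (by omega) (by omega)
    omega
  obtain ⟨p, hu, hv⟩ := eq_cons_append_of_count hl hc (fun k hk0 hk => by
    have := a1 k hk
    have := a2 k hk0 hk
    omega) hd
  exact ⟨p, by rw [hu, hv, swappedSquare]⟩

theorem strictLower_of_isAlmostBalanced {p : BinWord} (hz : IsAlmostBalanced (swappedSquare p)) :
    StrictLower (0 :: p ++ [1]) := by
  have pair : IsImbalancePair (swappedSquare p) (0 :: p ++ [0]) (1 :: p ++ [1]) :=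
    ⟨(List.suffix_append _ _).isInfix, (List.prefix_append _ _).isInfix, by simp, by simp⟩
  have hbal := fun {i j k} => not_imbalance_of_length_ne hz pair (i := i) (j := j) (k := k)
  have hlu : (0 :: p ++ [0]).length = p.length + 2 := by simp
  have hlc : (0 :: p ++ [1]).length = p.length + 2 := by simp
  rw [hlu, length_swappedSquare] at hbal
  have hL := fun {k} => count_take_swappedSquare_left p (k := k)
  have hR := fun {k} => count_take_swappedSquare_right p (k := k)
  have hT : ((swappedSquare p).take (p.length + 2 + (p.length + 2))).count 1 =
      2 * (0 :: p ++ [1]).count 1 := by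
    rw [← length_swappedSquare, List.take_length, count_swappedSquare]
  intro k hk0 hk
  rw [hlc] at hk ⊢
  generalize hn : p.length + 2 = n at *
  generalize hb : (0 :: p ++ [1]).count 1 = b at *
  set m : ℕ → ℕ := fun k => ((0 :: p ++ [1]).take k).count 1 with hm
  set Q : ℕ → ℕ := fun k => ((swappedSquare p).take k).count 1 with hQ
  change n * m k < b * k ∧ b * k < n * (m k + 1)
  replace hL : ∀ {k}, 0 < k → k < n → Q k = m k + 1 := hL
  replace hR : ∀ {k}, k < n → Q (n + k) = b + 1 + m k := hR
  replace hT : Q (n + n) = 2 * b := hT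
  replace hbal : ∀ {i j k}, i + k ≤ n + n → j + k ≤ n + n → k ≠ n →
      Q (j + k) + Q i ≤ Q (i + k) + Q j + 1 := hbal
  have hQ0 : Q 0 = 0 := by simp [hQ]
  have hm0 : m 0 = 0 := by simp [hm]
  have hQn : Q n = b + 1 := by simpa [hm0] using hR (k := 0) (by omega)
  have hQk := hL hk0 hk
  -- Windows of length `k` are compared with the prefix of `z`, with m k + 1 ones; `upper` uses the
  -- prefix of the second half, with m k ones.
  have lower : ∀ i < n, m k + Q (i + 1) ≤ Q (i + 1 + k) := by
    intro i hi
    have := hbal (i := i + 1) (j := 0) (k := k) (by omega) (by omega) (by omega)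
    rw [zero_add] at this
    omega
  have upper : ∀ i < n, Q (i + 1 + k) ≤ m k + 1 + Q (i + 1) := by
    intro i hi
    have := hbal (i := n) (j := i + 1) (k := k) (by omega) (by omega) (by omega)
    rw [hR hk] at this
    omega
  have hsum := sum_windows Q n k
  have hshift : ∑ i ∈ Finset.range k, Q (i + 1 + n) = ∑ i ∈ Finset.range k, (b + Q (i + 1)) := by
    refine Finset.sum_congr rfl fun i hi => ?_
    have hi := Finset.mem_range.mp hi
    rw [add_comm (i + 1) n, hR (by omega), hL (by omega) (by omega)]
    ring
  rw [hshift, Finset.sum_add_distrib, Finset.sum_const, Finset.card_range, smul_eq_mul] at hsum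
  -- By `hsum`, the n window counts add up to b·k. Strictness comes from the window ending at the
  -- midpoint: it has one more 1 than the final window of `z`, which already has at least m k.
  have s1 : ∑ i ∈ Finset.range n, (m k + Q (i + 1)) < ∑ i ∈ Finset.range n, Q (i + 1 + k) := by
    refine Finset.sum_lt_sum (fun i hi => lower i (Finset.mem_range.mp hi))
      ⟨n - k - 1, Finset.mem_range.mpr (by omega), ?_⟩
    have h1 := hbal (i := n + (n - k)) (j := 0) (k := k) (by omega) (by omega) (by omega)
    rw [show n + (n - k) + k = n + n by omega, hT, hR (by omega), zero_add, hQk, hQ0] at h1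
    rw [show n - k - 1 + 1 + k = n by omega, show n - k - 1 + 1 = n - k by omega, hQn,
      hL (by omega) (by omega)]
    omega
  -- Strictness comes from the window starting at the midpoint, which has exactly m k ones.
  have s2 : ∑ i ∈ Finset.range n, Q (i + 1 + k) <
      ∑ i ∈ Finset.range n, (m k + 1 + Q (i + 1)) := by
    refine Finset.sum_lt_sum (fun i hi => upper i (Finset.mem_range.mp hi))
      ⟨n - 1, Finset.mem_range.mpr (by omega), ?_⟩
    rw [show n - 1 + 1 = n by omega, hR hk, hQn]
    omega
  rw [Finset.sum_add_distrib, Finset.sum_const, Finset.card_range, smul_eq_mul] at s1 s2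
  rw [mul_comm b k]
  omega

theorem exists_eq_swappedSquare_or_reverse {z : BinWord} (hz : z ∈ MAB) :
    ∃ p, StrictLower (0 :: p ++ [1]) ∧ (z = swappedSquare p ∨ z = (swappedSquare p).reverse) := by
  have main : ∀ {z u v : BinWord}, z ∈ MAB → IsImbalancePair z u v → v <+: z → u <:+ z →
      ∃ p, StrictLower (0 :: p ++ [1]) ∧ z = swappedSquare p := by
    intro z u v hz huv hv hu
    obtain rfl := eq_append_of_prefix_suffix hz.1 huv hv hu
    obtain ⟨p, hp⟩ := exists_eq_swappedSquare hz.1 huv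
    exact ⟨p, strictLower_of_isAlmostBalanced (hp ▸ hz.1), hp⟩
  obtain ⟨⟨u, v⟩, huv, -⟩ := hz.1
  rcases prefix_suffix_of_mem_MAB hz huv with ⟨hv, hu⟩ | ⟨hu, hv⟩
  · obtain ⟨p, hp, h⟩ := main hz huv hv hu
    exact ⟨p, hp, .inl h⟩
  · obtain ⟨p, hp, h⟩ := main (mem_MAB_reverse hz) huv.reverse (List.reverse_prefix.mpr hv)
      (List.reverse_suffix.mpr hu)
    exact ⟨p, hp, .inr (by rw [← h, List.reverse_reverse])⟩

/-! ### The characterization -/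

theorem eq_of_square_eq {x y : Fin 2} {w c : BinWord} (hxy : x ≠ y)
    (h : [x] ++ w ++ [y] = c ++ c) :
    ∃ p, c = x :: p ++ [y] ∧ w = p ++ [y] ++ [x] ++ p := by
  rcases c with _ | ⟨x', c⟩
  · simp at h
  rcases List.eq_nil_or_concat c with rfl | ⟨p, y', rfl⟩
  · have hw : w.length = 0 := by simpa using congrArg List.length h
    rw [List.length_eq_zero_iff.mp hw] at h
    simp at h
    exact absurd (h.1.trans h.2.symm) hxy
  · have h' : x :: (w ++ [y]) = x' :: ((p ++ [y'] ++ [x'] ++ p) ++ [y']) := by simpa using h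
    obtain ⟨rfl, h'⟩ := List.cons.inj h'
    obtain ⟨rfl, h'⟩ := List.append_inj' h' rfl
    obtain rfl : y = y' := by simpa using h'
    exact ⟨p, by simp, rfl⟩

theorem mem_MAB_of_isLowerChristoffel {x y : Fin 2} {w c : BinWord} {a b : ℕ} (hxy : x ≠ y)
    (h : [x] ++ w ++ [y] = c ++ c) (hab : (a, b) ≠ (0, 0)) (hc : IsLowerChristoffel a b c)
    (hp : IsPrimitiveWord c) : [y] ++ w ++ [x] ∈ MAB := by
  obtain ⟨p, rfl, rfl⟩ := eq_of_square_eq hxy h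
  have hx : x = 0 ∧ y = 1 := by
    -- A path below the segment starting with a vertical step has a = 0, which its last letter 0
    -- contradicts.
    have hx : x ≠ 1 := by
      rintro rfl
      have hy : y = 0 := by omega
      have h1 := hc.1.2 [1] ⟨p ++ [y], rfl⟩
      have h2 := hc.1.1.1
      simp [hy] at h1 h2
      omega
    omega
  obtain ⟨rfl, rfl⟩ := hx
  have := swappedSquare_mem_MAB (hc.strictLower hab hp)
  simpa [swappedSquare] using this

theorem mainTheorem4 :
    MAB = {z : BinWord | ∃ (x y : Fin 2) (w : BinWord),
      z = [y] ++ w ++ [x] ∧ ({x, y} : Finset (Fin 2)) = {0, 1} ∧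
      ∃ c : BinWord, IsChristoffel c ∧ IsPrimitiveWord c ∧ [x] ++ w ++ [y] = c ++ c} ∧
    MAB ⊆ MinimalForbidden Bal := by
  refine ⟨Set.ext fun z => ⟨fun hz => ?_, ?_⟩, MAB_subset_minimalForbidden⟩
  · obtain ⟨p, hp, rfl | rfl⟩ := exists_eq_swappedSquare_or_reverse hz
    · exact ⟨0, 1, p ++ [1] ++ [0] ++ p, by simp [swappedSquare], rfl, 0 :: p ++ [1],
        ⟨_, _, by simp, .inl hp.isLowerChristoffel⟩, hp.isPrimitiveWord (by simp), by simp⟩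
    · exact ⟨1, 0, p.reverse ++ [0] ++ [1] ++ p.reverse, by simp [swappedSquare], by decide,
        (0 :: p ++ [1]).reverse, ⟨_, _, by simp, .inr hp.isLowerChristoffel.reverse⟩,
        (hp.isPrimitiveWord (by simp)).reverse, by simp⟩
  · rintro ⟨x, y, w, rfl, hxy, c, ⟨a, b, hab, hc⟩, hp, h⟩
    have hne : x ≠ y := by
      clear h
      revert hxy; revert x y; decide
    rcases hc with hc | hc
    · exact mem_MAB_of_isLowerChristoffel hne h hab hc hp
    · have h' : [y] ++ w.reverse ++ [x] = c.reverse ++ c.reverse := by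
        simpa using congrArg List.reverse h
      simpa using mem_MAB_reverse
        (mem_MAB_of_isLowerChristoffel hne.symm h' hab hc.reverse hp.reverse)
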